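/- For an integer $m$ let $\omega(m)=(-1)^k$ if $m=\frac{3k^2+k}{2}$ or $m=\frac{3k^2-k}{2}$ for some integer $k\ge 0$ (such a $k$ is unique; in particular $\omega(0)=1$), and $\omega(m)=0$ otherwise; in particular $\omega(m)=0$ for $m<0$. For integers $s\geq 1$ and $n\ge 0$ let $r_s(n)$ be the number of tuples $(x_1,\dots,x_s)\in\mathbb{Z}^s$ with $x_1^2+\cdots+x_s^2=n$. For an integer $m\geq 1$ put \[ \eta_1(m)=\begin{cases}0&\text{if } m \text{ is even},\\ (-1)^{\frac{m-1}{2}}&\text{if } m\text{ is odd},\end{cases} \qquad \eta_2(m)=\begin{cases}0&\text{if } 4\mid m,\\ m&\text{otherwise}.\end{cases} \] Theorem. For every integer $n\ge 0$ (for $n=0$ all sums below are empty), \begin{enumerate} \item[(a)] $\displaystyle\sum_{k=1}^{n}r_2(k)\,\omega(n-k)=4\sum_{\substack{m+k=n\\ m\ge 1,\ k\ge 0}}\eta_1(m)\bigl(\omega(k)+\omega(k-m)+\omega(k-2m)+\cdots\bigr)$; \item[(b)] $\displaystyle\sum_{k=1}^{n}r_4(k)\,\omega(n-k)=8\sum_{\substack{m+k=n\\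 m\ge 1,\ k\ge 0}}\eta_2(m)\bigl(\omega(k)+\omega(k-m)+\omega(k-2m)+\cdots\bigr)$; \item[(c)] $\displaystyle\sum_{k=1}^{n}(-1)^k r_8(k)\,\omega(n-k)=16\sum_{\substack{m+k=n\\ m\ge 1,\ k\ge 0}}(-1)^m m^3\bigl(\omega(k)+\omega(k-m)+\omega(k-2m)+\cdots\bigr)$. \end{enumerate} -/

import Mathlib

/-- The coefficients of Euler's pentagonal number theorem, as a function on all integers:
`ω(m) = (-1)^k` if `m = (3k² + k)/2` or `m = (3k² - k)/2` for a natural number `k`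
(so `ω(0) = 1`, from `k = 0`), and `ω(m) = 0` for every other integer; in particular `ω(m) = 0`
for `m < 0`. There is at most one such `k`, see `pentagonalCoeff_of_eq`. -/
noncomputable def pentagonalCoeff (m : ℤ) : ℤ :=
  open Classical in
  if h : ∃ k : ℕ, 2 * m = 3 * (k : ℤ) ^ 2 + k ∨ 2 * m = 3 * (k : ℤ) ^ 2 - k then
    (-1) ^ h.choose
  else 0

theorem pentagonal_index_unique {m : ℤ} {k l : ℕ}
    (hk : 2 * m = 3 * (k : ℤ) ^ 2 + k ∨ 2 * m = 3 * (k : ℤ) ^ 2 - k)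
    (hl : 2 * m = 3 * (l : ℤ) ^ 2 + l ∨ 2 * m = 3 * (l : ℤ) ^ 2 - l) : k = l := by
  rcases lt_trichotomy k l with h | h | h
  · exfalso
    have h' : (k : ℤ) + 1 ≤ l := by exact_mod_cast h
    have h0 : (0 : ℤ) ≤ k := by positivity
    rcases hk with hk | hk <;> rcases hl with hl | hl <;> nlinarith
  · exact h
  · exfalso
    have h' : (l : ℤ) + 1 ≤ k := by exact_mod_cast h
    have h0 : (0 : ℤ) ≤ l := by positivity
    rcases hk with hk | hk <;> rcases hl with hl | hl <;> nlinarith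

theorem pentagonalCoeff_of_eq {m : ℤ} {k : ℕ}
    (hk : 2 * m = 3 * (k : ℤ) ^ 2 + k ∨ 2 * m = 3 * (k : ℤ) ^ 2 - k) :
    pentagonalCoeff m = (-1) ^ k := by
  have h : ∃ k : ℕ, 2 * m = 3 * (k : ℤ) ^ 2 + k ∨ 2 * m = 3 * (k : ℤ) ^ 2 - k := ⟨k, hk⟩
  rw [pentagonalCoeff, dif_pos h, pentagonal_index_unique h.choose_spec hk]

theorem pentagonalCoeff_of_neg {m : ℤ} (hm : m < 0) : pentagonalCoeff m = 0 := by
  rw [pentagonalCoeff, dif_neg]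
  rintro ⟨k, hk | hk⟩ <;> nlinarith [sq_nonneg (k : ℤ), Int.le_self_sq (k : ℤ)]

/-- On natural numbers `pentagonalCoeff` gives the coefficients of Mathlib's pentagonal series. -/
theorem pentagonalCoeff_natCast (n : ℕ) :
    pentagonalCoeff (n : ℤ) = (PowerSeries.pentagonalSeries ℤ).coeff n := by
  by_cases h : n ∈ Set.range pentagonal
  · obtain ⟨k, rfl⟩ := h
    rw [PowerSeries.coeff_pentagonalSeries_pentagonal]
    have h2 := two_mul_natCast_pentagonal k
    obtain ⟨l, rfl | rfl⟩ := k.eq_nat_or_neg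
    · rw [pentagonalCoeff_of_eq (k := l) (Or.inr (by rw [h2]; ring))]
      simp [Int.negOnePow_def]
    · rw [pentagonalCoeff_of_eq (k := l) (Or.inl (by rw [h2]; ring))]
      simp [Int.negOnePow_def]
  · rw [PowerSeries.coeff_pentagonalSeries_eq_zero ℤ h, pentagonalCoeff, dif_neg]
    rintro ⟨k, hk | hk⟩
    · refine h ⟨-(k : ℤ), ?_⟩
      have h2 := two_mul_natCast_pentagonal_neg (k : ℤ)
      have : (pentagonal (-(k : ℤ)) : ℤ) = n := by linarith
      exact_mod_cast this
    · refine h ⟨(k : ℤ), ?_⟩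
      have h2 := two_mul_natCast_pentagonal (k : ℤ)
      have : (pentagonal (k : ℤ) : ℤ) = n := by linarith
      exact_mod_cast this

/-- The sum `ω(k) + ω(k - m) + ω(k - 2m) + ⋯`. For `m ≥ 1` it has only finitely many nonzero
terms, see `pentagonalProgressionSum_eq`. -/
noncomputable def pentagonalProgressionSum (m k : ℕ) : ℤ :=
  ∑ᶠ j : ℕ, pentagonalCoeff ((k : ℤ) - (j : ℤ) * (m : ℤ))

theorem pentagonalProgressionSum_eq {m : ℕ} (hm : 1 ≤ m) (k : ℕ) :
    pentagonalProgressionSum m k =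
      ∑ j ∈ Finset.range (k + 1), pentagonalCoeff ((k : ℤ) - (j : ℤ) * (m : ℤ)) := by
  refine finsum_eq_sum_of_support_subset _ fun j hj => ?_
  by_contra hjk
  apply hj
  apply pentagonalCoeff_of_neg
  have h1 : (k : ℤ) + 1 ≤ j := by
    have : k + 1 ≤ j := by simpa using hjk
    exact_mod_cast this
  have h2 : (1 : ℤ) ≤ m := by exact_mod_cast hm
  nlinarith

/-- `sumSquaresCount s n` is `r_s(n)`, the number of `s`-tuples of integers `(x_1, …, x_s)`
with `x_1² + ⋯ + x_s² = n` (order and signs are taken into account). -/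
noncomputable def sumSquaresCount (s n : ℕ) : ℕ :=
  {x : Fin s → ℤ | ∑ i, x i ^ 2 = (n : ℤ)}.ncard

theorem finite_sumSquares (s n : ℕ) : {x : Fin s → ℤ | ∑ i, x i ^ 2 = (n : ℤ)}.Finite := by
  refine (Set.finite_Icc (fun _ : Fin s => -(n : ℤ)) (fun _ => (n : ℤ))).subset fun x hx => ?_
  have key : ∀ i, x i ^ 2 ≤ (n : ℤ) := fun i => by
    rw [← show ∑ i, x i ^ 2 = (n : ℤ) from hx]
    exact Finset.single_le_sum (f := fun i => x i ^ 2) (fun j _ => sq_nonneg (x j))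
      (Finset.mem_univ i)
  refine ⟨fun i => ?_, fun i => ?_⟩
  · have := key i
    have h2 := Int.le_self_sq (-x i)
    show -(n : ℤ) ≤ x i
    nlinarith
  · exact (Int.le_self_sq (x i)).trans (key i)

/-- `η₁(n) = 0` for even `n`, and `η₁(n) = (-1)^((n-1)/2)` for odd `n`. -/
def etaOne (n : ℕ) : ℤ := if Even n then 0 else (-1) ^ ((n - 1) / 2)

/-- `η₂(n) = 0` if `4 ∣ n`, and `η₂(n) = n` otherwise. -/
def etaTwo (n : ℕ) : ℤ := if 4 ∣ n then 0 else (n : ℤ)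

/-! All three parts follow from Jacobi's formulas, which express `r_2(k)`, `r_4(k)` and `(-1)^k
r_8(k)` for `k ≥ 1` as a constant times `∑_{d ∣ k} η(d)`. Writing each `k` as `m (j + 1)` with `m`
the divisor gives `ω(n - k) = ω((n - m) - j m)`, so the right side is the left side regrouped by `m`
(`sum_divisors_mul_pentagonalCoeff`). The only property of `ω` used is that it vanishes on negative
integers.

Jacobi's formulas are proved by the elementary method of Liouville and Uspensky. By symmetry among
the `m + 1` coordinates, `∑_i (n - (m + 1) i²) r_m(n - i²) = 0`; together with `r_m(0) = 1` this
determines `r_m`. A divisor sum `2m ∑_{dδ = k} h(d, δ)`, with value `1` put in at `k = 0`, satisfies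
the same recursion as soon as `∑_{i² + dδ = n} (n - (m + 1) i²) h(d, δ)` is `n` for square `n` and
`0` otherwise (`sumSquaresCount_eq_of_sum_quadTriples`).

These weighted sums come from `liouville_identity` for suitable functions `F`. Symmetrising in `i ↦
-i` or `d ↔ δ` turns one side into the desired sum; the other side vanishes or cancels, except for
boundary terms that exist only when `n` is a square. -/

/-! ### Counting sums of squares, and the recursion that determines the counts -/

/-- The number of `m`-tuples of integers whose squares add up to the integer `k`. -/
noncomputable def sumSquaresCountInt (m : ℕ) (k : ℤ) : ℤ :=
  ({x : Fin m → ℤ | ∑ i, x i ^ 2 = k}.ncard : ℤ)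

theorem sumSquaresCountInt_natCast (m n : ℕ) :
    sumSquaresCountInt m (n : ℤ) = sumSquaresCount m n := rfl

theorem sumSquaresCountInt_of_neg (m : ℕ) {k : ℤ} (hk : k < 0) : sumSquaresCountInt m k = 0 := by
  have : {x : Fin m → ℤ | ∑ i, x i ^ 2 = k} = ∅ := by
    ext x
    simp only [Set.mem_ofPred_eq, Set.mem_empty_iff_false, iff_false]
    have := Finset.sum_nonneg (s := Finset.univ) (f := fun i => x i ^ 2) fun i _ => sq_nonneg (x i)
    intro h
    omega
  simp [sumSquaresCountInt, this]

theorem sumSquaresCountInt_zero (m : ℕ) : sumSquaresCountInt m 0 = 1 := by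
  have : {x : Fin m → ℤ | ∑ i, x i ^ 2 = 0} = {0} := by
    ext x
    simp only [Set.mem_ofPred_eq, Set.mem_singleton_iff]
    rw [Finset.sum_eq_zero_iff_of_nonneg fun i _ => sq_nonneg (x i)]
    simp [funext_iff]
  simp [sumSquaresCountInt, this]

/-- The tuples of `m` integers whose squares add up to `n`. -/
noncomputable def squareTuples (m n : ℕ) : Finset (Fin m → ℤ) := (finite_sumSquares m n).toFinset

theorem mem_squareTuples {m n : ℕ} {x : Fin m → ℤ} :
    x ∈ squareTuples m n ↔ ∑ i, x i ^ 2 = (n : ℤ) := by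
  simp [squareTuples]

theorem sum_squareTuples_sq_eq (m n : ℕ) (j : Fin (m + 1)) :
    ∑ x ∈ squareTuples (m + 1) n, x j ^ 2 = ∑ x ∈ squareTuples (m + 1) n, x 0 ^ 2 := by
  have hmem : ∀ x ∈ squareTuples (m + 1) n, x ∘ Equiv.swap 0 j ∈ squareTuples (m + 1) n := by
    intro x hx
    rw [mem_squareTuples] at hx ⊢
    rw [← hx]
    exact Equiv.sum_comp (Equiv.swap 0 j) fun i => x i ^ 2
  refine Finset.sum_nbij' (fun x => x ∘ Equiv.swap 0 j) (fun x => x ∘ Equiv.swap 0 j)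
    hmem hmem ?_ ?_ ?_
  · intro x _
    ext i
    simp
  · intro x _
    ext i
    simp
  · intro x _
    simp

/-- Permuting coordinates shows that all `m + 1` of them have the same total of squares over the
tuples, and these totals add up to `n` times the number of tuples. -/
theorem sum_squareTuples_eq_zero (m n : ℕ) :
    ∑ x ∈ squareTuples (m + 1) n, ((n : ℤ) - (m + 1) * x 0 ^ 2) = 0 := by
  have h : ∑ x ∈ squareTuples (m + 1) n, (n : ℤ) =
      ∑ j : Fin (m + 1), ∑ x ∈ squareTuples (m + 1) n, x j ^ 2 := by
    rw [Finset.sum_comm]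
    exact Finset.sum_congr rfl fun x hx => (mem_squareTuples.1 hx).symm
  rw [Finset.sum_sub_distrib, h, ← Finset.mul_sum,
    Finset.sum_congr rfl fun j _ => sum_squareTuples_sq_eq m n j]
  simp

theorem sum_squareTuples_head (m n : ℕ) (f : ℤ → ℤ) :
    ∑ x ∈ squareTuples (m + 1) n, f (x 0) =
      ∑ i ∈ Finset.Icc (-(n : ℤ)) n, f i * sumSquaresCountInt m (n - i ^ 2) := by
  have hmaps : ∀ x ∈ squareTuples (m + 1) n, x 0 ∈ Finset.Icc (-(n : ℤ)) n := by
    intro x hx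
    rw [mem_squareTuples, Fin.sum_univ_succ] at hx
    have h0 := Finset.sum_nonneg (s := Finset.univ) (f := fun i : Fin m => x i.succ ^ 2)
      fun i _ => sq_nonneg (x i.succ)
    have h1 := Int.le_self_sq (x 0)
    have h2 := Int.le_self_sq (-x 0)
    rw [Finset.mem_Icc]
    constructor <;> nlinarith
  rw [← Finset.sum_fiberwise_of_maps_to hmaps]
  refine Finset.sum_congr rfl fun i _ => ?_
  rw [Finset.sum_congr rfl (g := fun _ => f i) fun x hx => by rw [(Finset.mem_filter.1 hx).2],
    Finset.sum_const, nsmul_eq_mul, mul_comm]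
  congr 1
  rw [sumSquaresCountInt, ← Set.ncard_coe_finset]
  congr 1
  symm
  refine Set.ncard_congr (fun y _ => Fin.cons i y) ?_ ?_ ?_
  · intro y hy
    have hy' : ∑ j, y j ^ 2 = (n : ℤ) - i ^ 2 := hy
    simp [mem_squareTuples, Fin.sum_univ_succ, hy']
  · intro y z _ _ h
    exact Fin.cons_right_injective (α := fun _ => ℤ) i h
  · intro x hx
    simp only [Finset.coe_filter, Set.mem_ofPred_eq, mem_squareTuples, Fin.sum_univ_succ] at hx
    refine ⟨Fin.tail x, ?_, ?_⟩
    · simp only [Set.mem_ofPred_eq, Fin.tail, ← hx.1, ← hx.2]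
      ring
    · rw [← hx.2]
      exact Fin.cons_self_tail x

/-- The recursion that determines the number of representations as sums of `m` squares. -/
theorem sum_mul_sumSquaresCountInt (m n : ℕ) :
    ∑ i ∈ Finset.Icc (-(n : ℤ)) n,
      ((n : ℤ) - (m + 1) * i ^ 2) * sumSquaresCountInt m (n - i ^ 2) = 0 := by
  rw [← sum_squareTuples_head m n fun i => (n : ℤ) - (m + 1) * i ^ 2]
  exact sum_squareTuples_eq_zero m n

/-- In the recursion the term `i = 0` is `n * g n`, and every other term involves a smaller
argument, so strong induction applies once `n ≠ 0` is cancelled. -/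
theorem eq_sumSquaresCountInt_of_recursion (m : ℕ) (g : ℤ → ℤ) (hneg : ∀ k < 0, g k = 0)
    (h0 : g 0 = 1)
    (hrec : ∀ n : ℕ, 0 < n → ∑ i ∈ Finset.Icc (-(n : ℤ)) n,
      ((n : ℤ) - (m + 1) * i ^ 2) * g (n - i ^ 2) = 0) (n : ℕ) :
    g n = sumSquaresCountInt m n := by
  induction n using Nat.strong_induction_on with
  | _ n ih =>
    rcases Nat.eq_zero_or_pos n with rfl | hn
    · simpa [sumSquaresCountInt_zero] using h0
    · have hz : (0 : ℤ) ∈ Finset.Icc (-(n : ℤ)) n := by simp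
      have h1 := hrec n hn
      have h2 := sum_mul_sumSquaresCountInt m n
      rw [← Finset.add_sum_erase _ _ hz] at h1 h2
      have h3 : ∑ i ∈ (Finset.Icc (-(n : ℤ)) n).erase 0,
          ((n : ℤ) - (m + 1) * i ^ 2) * g (n - i ^ 2) =
          ∑ i ∈ (Finset.Icc (-(n : ℤ)) n).erase 0,
          ((n : ℤ) - (m + 1) * i ^ 2) * sumSquaresCountInt m (n - i ^ 2) := by
        refine Finset.sum_congr rfl fun i hi => ?_
        have hi0 : 0 < i ^ 2 := by
          have := (Finset.mem_erase.1 hi).1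
          positivity
        congr 1
        rcases lt_or_ge ((n : ℤ) - i ^ 2) 0 with h | h
        · rw [hneg _ h, sumSquaresCountInt_of_neg m h]
        · lift (n : ℤ) - i ^ 2 to ℕ using h with k hk
          exact ih k (by omega)
      have hn' : (n : ℤ) ≠ 0 := by exact_mod_cast hn.ne'
      have h4 : (n : ℤ) * g n = n * sumSquaresCountInt m n := by
        simp only [ne_eq, OfNat.ofNat_ne_zero, not_false_eq_true, zero_pow, mul_zero,
          sub_zero] at h1 h2
        linarith
      exact mul_left_cancel₀ hn' h4

/-! ### The Liouville–Uspensky identity -/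

/-- The solutions `(i, d, δ)` of `i² + d δ = n` with `d` and `δ` positive. -/
noncomputable def quadTriples (n : ℤ) : Finset (ℤ × ℤ × ℤ) :=
  {p ∈ Finset.Icc (-n) n ×ˢ Finset.Icc 1 n ×ˢ Finset.Icc 1 n | p.1 ^ 2 + p.2.1 * p.2.2 = n}

theorem mem_quadTriples {n i d e : ℤ} :
    (i, d, e) ∈ quadTriples n ↔ 0 < d ∧ 0 < e ∧ i ^ 2 + d * e = n := by
  simp only [quadTriples, Finset.mem_filter, Finset.mem_product, Finset.mem_Icc]
  constructor
  · rintro ⟨⟨_, ⟨h1, _⟩, h2, _⟩, h⟩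
    exact ⟨by omega, by omega, h⟩
  · rintro ⟨hd, he, h⟩
    have h1 := Int.le_self_sq i
    have h2 := Int.le_self_sq (-i)
    refine ⟨⟨⟨?_, ?_⟩, ⟨?_, ?_⟩, ?_, ?_⟩, h⟩ <;> nlinarith [sq_nonneg i, mul_pos hd he]

theorem sum_quadTriples_neg (n : ℤ) (f : ℤ × ℤ × ℤ → ℤ) :
    ∑ p ∈ quadTriples n, f (-p.1, p.2) = ∑ p ∈ quadTriples n, f p := by
  have hmem : ∀ p ∈ quadTriples n, (-p.1, p.2) ∈ quadTriples n := by
    rintro ⟨i, d, e⟩ h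
    rw [mem_quadTriples] at h ⊢
    simpa using h
  exact Finset.sum_nbij' (fun p => (-p.1, p.2)) (fun p => (-p.1, p.2)) hmem hmem
    (fun p _ => by simp) (fun p _ => by simp) (fun p _ => rfl)

theorem sum_quadTriples_swap (n : ℤ) (f : ℤ × ℤ × ℤ → ℤ) :
    ∑ p ∈ quadTriples n, f (p.1, p.2.2, p.2.1) = ∑ p ∈ quadTriples n, f p := by
  have hmem : ∀ p ∈ quadTriples n, (p.1, p.2.2, p.2.1) ∈ quadTriples n := by
    rintro ⟨i, d, e⟩ h
    rw [mem_quadTriples] at h ⊢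
    exact ⟨h.2.1, h.1, by linarith [h.2.2, mul_comm d e]⟩
  exact Finset.sum_nbij' (fun p => (p.1, p.2.2, p.2.1)) (fun p => (p.1, p.2.2, p.2.1)) hmem hmem
    (fun p _ => rfl) (fun p _ => rfl) (fun p _ => rfl)

section Liouville

variable {F : ℤ → ℤ → ℤ → ℤ}

/-- On this region `(i, d, δ) ↦ (δ - i, d + 2i - δ, δ)` is an involution that negates the first
argument of `F` and fixes the other two, so the sum equals its own negative. -/
theorem sum_quadTriples_filter_lt (hx : ∀ x y z, F (-x) y z = -F x y z) (n : ℤ) :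
    ∑ p ∈ quadTriples n with p.2.2 < p.2.1 + 2 * p.1,
      F (p.2.2 - 2 * p.1) (p.2.1 + p.1) (2 * p.2.1 + 2 * p.1 - p.2.2) = 0 := by
  set S := (quadTriples n).filter fun p => p.2.2 < p.2.1 + 2 * p.1 with hS
  have hmem : ∀ p ∈ S, (p.2.2 - p.1, p.2.1 + 2 * p.1 - p.2.2, p.2.2) ∈ S := by
    rintro ⟨i, d, e⟩ h
    rw [hS, Finset.mem_filter, mem_quadTriples] at h ⊢
    obtain ⟨⟨hd, he, h⟩, h'⟩ := h
    dsimp only at h' ⊢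
    refine ⟨⟨by omega, he, ?_⟩, by omega⟩
    rw [← h]
    ring
  have key : ∑ p ∈ S, F (p.2.2 - 2 * p.1) (p.2.1 + p.1) (2 * p.2.1 + 2 * p.1 - p.2.2) =
      ∑ p ∈ S, -F (p.2.2 - 2 * p.1) (p.2.1 + p.1) (2 * p.2.1 + 2 * p.1 - p.2.2) := by
    refine Finset.sum_nbij' (fun p => (p.2.2 - p.1, p.2.1 + 2 * p.1 - p.2.2, p.2.2))
      (fun p => (p.2.2 - p.1, p.2.1 + 2 * p.1 - p.2.2, p.2.2)) hmem hmem ?_ ?_ ?_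
    · rintro ⟨i, d, e⟩ _
      ext <;> dsimp only <;> ring
    · rintro ⟨i, d, e⟩ _
      ext <;> dsimp only <;> ring
    · rintro ⟨i, d, e⟩ _
      dsimp only
      rw [← hx]
      congr 1 <;> ring
  rw [Finset.sum_neg_distrib] at key
  linarith

/-- The linear substitution `(i, d, δ) ↦ (d + i, d, δ - d - 2i)` preserves both the form `i² + dδ`
and the arguments of `F`. Each region's inequality is the positivity of the last coordinate of the
image in the other. -/
theorem sum_quadTriples_filter_gt (n : ℤ) :
    ∑ p ∈ quadTriples n with p.2.1 + 2 * p.1 < p.2.2,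
      F (p.2.2 - 2 * p.1) (p.2.1 + p.1) (2 * p.2.1 + 2 * p.1 - p.2.2) =
    ∑ p ∈ quadTriples n with p.2.1 - p.2.2 < 2 * p.1,
      F (p.2.1 + p.2.2) p.1 (p.2.1 - p.2.2) := by
  refine Finset.sum_nbij' (fun p => (p.2.1 + p.1, p.2.1, p.2.2 - p.2.1 - 2 * p.1))
    (fun p => (p.1 - p.2.1, p.2.1, p.2.2 + 2 * p.1 - p.2.1)) ?_ ?_ ?_ ?_ ?_
  · rintro ⟨i, d, e⟩ h
    rw [Finset.mem_filter, mem_quadTriples] at h ⊢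
    obtain ⟨⟨hd, he, h⟩, h'⟩ := h
    dsimp only at h' ⊢
    refine ⟨⟨hd, by omega, ?_⟩, by omega⟩
    rw [← h]
    ring
  · rintro ⟨i, d, e⟩ h
    rw [Finset.mem_filter, mem_quadTriples] at h ⊢
    obtain ⟨⟨hd, he, h⟩, h'⟩ := h
    dsimp only at h' ⊢
    refine ⟨⟨hd, by omega, ?_⟩, by omega⟩
    rw [← h]
    ring
  · rintro ⟨i, d, e⟩ _
    ext <;> dsimp only <;> ring
  · rintro ⟨i, d, e⟩ _
    ext <;> dsimp only <;> ring
  · rintro ⟨i, d, e⟩ _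
    dsimp only
    congr 1 <;> ring

/-- The map `(i, d, δ) ↦ (-i, δ, d)` exchanges the two regions and negates the last two arguments of
`F`. -/
theorem sum_quadTriples_filter_symm (hyz : ∀ x y z, F x (-y) (-z) = F x y z) (n : ℤ) :
    ∑ p ∈ quadTriples n with 2 * p.1 < p.2.1 - p.2.2, F (p.2.1 + p.2.2) p.1 (p.2.1 - p.2.2) =
    ∑ p ∈ quadTriples n with p.2.1 - p.2.2 < 2 * p.1, F (p.2.1 + p.2.2) p.1 (p.2.1 - p.2.2) := by
  refine Finset.sum_nbij' (fun p => (-p.1, p.2.2, p.2.1)) (fun p => (-p.1, p.2.2, p.2.1))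
    ?_ ?_ ?_ ?_ ?_
  · rintro ⟨i, d, e⟩ h
    rw [Finset.mem_filter, mem_quadTriples] at h ⊢
    obtain ⟨⟨hd, he, h⟩, h'⟩ := h
    dsimp only at h' ⊢
    refine ⟨⟨he, hd, ?_⟩, by omega⟩
    rw [← h]
    ring
  · rintro ⟨i, d, e⟩ h
    rw [Finset.mem_filter, mem_quadTriples] at h ⊢
    obtain ⟨⟨hd, he, h⟩, h'⟩ := h
    dsimp only at h' ⊢
    refine ⟨⟨he, hd, ?_⟩, by omega⟩
    rw [← h]
    ring
  · rintro ⟨i, d, e⟩ _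
    simp
  · rintro ⟨i, d, e⟩ _
    simp
  · rintro ⟨i, d, e⟩ _
    dsimp only
    rw [← hyz]
    congr 1 <;> ring

theorem sum_trichotomy {ι : Type*} (S : Finset ι) (u v : ι → ℤ) (f : ι → ℤ) :
    ∑ p ∈ S, f p = ∑ p ∈ S with u p < v p, f p + ∑ p ∈ S with v p < u p, f p +
      ∑ p ∈ S with u p = v p, f p := by
  simp only [Finset.sum_filter, ← Finset.sum_add_distrib]
  refine Finset.sum_congr rfl fun p _ => ?_
  rcases lt_trichotomy (u p) (v p) with h | h | h
  · simp [h, h.not_gt, h.ne]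
  · simp [h]
  · simp [h, h.not_gt, h.ne']

/-- An identity of Liouville and Uspensky: a function on the quadric `x² + 4y² - z² = 4n` that is
odd in `x` and even in `(y, z)`, summed over two regions of its integral points. -/
theorem liouville_identity (hx : ∀ x y z, F (-x) y z = -F x y z)
    (hyz : ∀ x y z, F x (-y) (-z) = F x y z) (n : ℤ) :
    2 * ∑ p ∈ quadTriples n, F (p.2.2 - 2 * p.1) (p.2.1 + p.1) (2 * p.2.1 + 2 * p.1 - p.2.2) =
      ∑ p ∈ quadTriples n, F (p.2.1 + p.2.2) p.1 (p.2.1 - p.2.2) +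
      2 * ∑ p ∈ quadTriples n with p.2.2 = p.2.1 + 2 * p.1, F p.2.1 (p.2.1 + p.1) p.2.1 -
      ∑ p ∈ quadTriples n with 2 * p.1 = p.2.1 - p.2.2,
        F (p.2.1 + p.2.2) p.1 (p.2.1 - p.2.2) := by
  rw [sum_trichotomy (quadTriples n) (fun p => p.2.2) (fun p => p.2.1 + 2 * p.1),
    sum_trichotomy (quadTriples n) (fun p => 2 * p.1) (fun p => p.2.1 - p.2.2)
      (fun p => F (p.2.1 + p.2.2) p.1 (p.2.1 - p.2.2)),
    sum_quadTriples_filter_lt hx, sum_quadTriples_filter_gt, sum_quadTriples_filter_symm hyz]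
  have : ∑ p ∈ quadTriples n with p.2.2 = p.2.1 + 2 * p.1,
      F (p.2.2 - 2 * p.1) (p.2.1 + p.1) (2 * p.2.1 + 2 * p.1 - p.2.2) =
      ∑ p ∈ quadTriples n with p.2.2 = p.2.1 + 2 * p.1, F p.2.1 (p.2.1 + p.1) p.2.1 := by
    refine Finset.sum_congr rfl fun p hp => ?_
    have h := (Finset.mem_filter.1 hp).2
    congr 1 <;> rw [h] <;> ring
  rw [this]
  ring

theorem liouville_identity_of_not_isSquare (hx : ∀ x y z, F (-x) y z = -F x y z)
    (hyz : ∀ x y z, F x (-y) (-z) = F x y z) {n : ℤ} (hn : ¬IsSquare n) :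
    2 * ∑ p ∈ quadTriples n, F (p.2.2 - 2 * p.1) (p.2.1 + p.1) (2 * p.2.1 + 2 * p.1 - p.2.2) =
      ∑ p ∈ quadTriples n, F (p.2.1 + p.2.2) p.1 (p.2.1 - p.2.2) := by
  -- On either boundary `i² + dδ` becomes a perfect square: `(i + d)²` here, `(i + δ)²` for the
  -- other.
  have h1 : {p ∈ quadTriples n | p.2.2 = p.2.1 + 2 * p.1} = ∅ := by
    refine Finset.filter_eq_empty_iff.2 ?_
    rintro ⟨i, d, e⟩ hp h
    obtain ⟨_, _, hp⟩ := mem_quadTriples.1 hp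
    dsimp only at h
    subst h
    exact hn ⟨i + d, by rw [← hp]; ring⟩
  have h2 : {p ∈ quadTriples n | 2 * p.1 = p.2.1 - p.2.2} = ∅ := by
    refine Finset.filter_eq_empty_iff.2 ?_
    rintro ⟨i, d, e⟩ hp h
    obtain ⟨_, _, hp⟩ := mem_quadTriples.1 hp
    dsimp only at h
    obtain rfl : d = e + 2 * i := by omega
    exact hn ⟨i + e, by rw [← hp]; ring⟩
  rw [liouville_identity hx hyz, h1, h2]
  simp

theorem liouville_identity_sq (hx : ∀ x y z, F (-x) y z = -F x y z)
    (hyz : ∀ x y z, F x (-y) (-z) = F x y z) (s : ℕ) :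
    2 * ∑ p ∈ quadTriples ((s : ℤ) ^ 2),
        F (p.2.2 - 2 * p.1) (p.2.1 + p.1) (2 * p.2.1 + 2 * p.1 - p.2.2) =
      ∑ p ∈ quadTriples ((s : ℤ) ^ 2), F (p.2.1 + p.2.2) p.1 (p.2.1 - p.2.2) +
      2 * ∑ x ∈ Finset.Ioo (0 : ℤ) (2 * s), F x s x -
      ∑ y ∈ Finset.Ioo (-(s : ℤ)) s, F (2 * s) y (2 * y) := by
  have h1 : ∑ p ∈ quadTriples ((s : ℤ) ^ 2) with p.2.2 = p.2.1 + 2 * p.1,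
      F p.2.1 (p.2.1 + p.1) p.2.1 = ∑ x ∈ Finset.Ioo (0 : ℤ) (2 * s), F x s x := by
    have aux : ∀ i d e : ℤ, (i, d, e) ∈ quadTriples ((s : ℤ) ^ 2) → e = d + 2 * i →
        d + i = s := by
      intro i d e hp h
      obtain ⟨hd, he, hp⟩ := mem_quadTriples.1 hp
      subst h
      exact (sq_eq_sq₀ (by omega) (by positivity)).1 (by rw [← hp]; ring)
    refine Finset.sum_nbij' (fun p => p.2.1) (fun x => ((s : ℤ) - x, x, 2 * s - x)) ?_ ?_ ?_ ?_ ?_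
    · rintro ⟨i, d, e⟩ hp
      obtain ⟨hp, h⟩ := Finset.mem_filter.1 hp
      have := aux i d e hp h
      obtain ⟨hd, he, hp⟩ := mem_quadTriples.1 hp
      dsimp only at h ⊢
      rw [Finset.mem_Ioo]
      omega
    · intro x hxs
      rw [Finset.mem_Ioo] at hxs
      rw [Finset.mem_filter, mem_quadTriples]
      refine ⟨⟨hxs.1, by omega, by ring⟩, ?_⟩
      dsimp only
      ring
    · rintro ⟨i, d, e⟩ hp
      obtain ⟨hp, h⟩ := Finset.mem_filter.1 hp
      have := aux i d e hp h
      dsimp only at h ⊢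
      ext <;> dsimp only <;> omega
    · intro x _
      rfl
    · rintro ⟨i, d, e⟩ hp
      obtain ⟨hp, h⟩ := Finset.mem_filter.1 hp
      dsimp only
      rw [aux i d e hp h]
  have h2 : ∑ p ∈ quadTriples ((s : ℤ) ^ 2) with 2 * p.1 = p.2.1 - p.2.2,
      F (p.2.1 + p.2.2) p.1 (p.2.1 - p.2.2) =
      ∑ y ∈ Finset.Ioo (-(s : ℤ)) s, F (2 * s) y (2 * y) := by
    have aux : ∀ i d e : ℤ, (i, d, e) ∈ quadTriples ((s : ℤ) ^ 2) → 2 * i = d - e →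
        d = s + i ∧ e = s - i := by
      intro i d e hp h
      obtain ⟨hd, he, hp⟩ := mem_quadTriples.1 hp
      obtain rfl : d = e + 2 * i := by omega
      have : e + i = s := (sq_eq_sq₀ (by omega) (by positivity)).1 (by rw [← hp]; ring)
      omega
    refine Finset.sum_nbij' (fun p => p.1) (fun y => (y, (s : ℤ) + y, (s : ℤ) - y)) ?_ ?_ ?_ ?_ ?_
    · rintro ⟨i, d, e⟩ hp
      obtain ⟨hp, h⟩ := Finset.mem_filter.1 hp
      have := aux i d e hp h
      obtain ⟨hd, he, hp⟩ := mem_quadTriples.1 hp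
      dsimp only at h ⊢
      rw [Finset.mem_Ioo]
      omega
    · intro y hy
      rw [Finset.mem_Ioo] at hy
      rw [Finset.mem_filter, mem_quadTriples]
      refine ⟨⟨by omega, by omega, by ring⟩, ?_⟩
      dsimp only
      ring
    · rintro ⟨i, d, e⟩ hp
      obtain ⟨hp, h⟩ := Finset.mem_filter.1 hp
      have := aux i d e hp h
      ext <;> dsimp only <;> omega
    · intro y _
      rfl
    · rintro ⟨i, d, e⟩ hp
      obtain ⟨hp, h⟩ := Finset.mem_filter.1 hp
      obtain ⟨rfl, rfl⟩ := aux i d e hp h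
      dsimp only
      congr 1 <;> ring
  rw [liouville_identity hx hyz, h1, h2]

end Liouville

/-! ### Parity signs, the character `χ₄` and boundary sums -/

/-- The factor `1 + (-1)^d` selects even `d`, where `(d, δ) ↦ (2δ, d/2)` is an involution preserving
`dδ` and negating `d - 2δ`. -/
theorem sum_quadTriples_even (n : ℤ) (q : ℤ → ℤ) :
    ∑ p ∈ quadTriples n, q p.1 * (1 + (p.2.1.negOnePow : ℤ)) * (p.2.1 - 2 * p.2.2) = 0 := by
  have h : ∀ p : ℤ × ℤ × ℤ, ∀ c : ℤ, q p.1 * (1 + (p.2.1.negOnePow : ℤ)) * c =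
      if Even p.2.1 then 2 * q p.1 * c else 0 := by
    intro p c
    split_ifs with hp
    · rw [Int.negOnePow_even _ hp]
      push_cast
      ring
    · rw [Int.negOnePow_odd _ (Int.not_even_iff_odd.1 hp)]
      simp
  simp_rw [h, ← Finset.sum_filter, mul_sub, Finset.sum_sub_distrib]
  rw [sub_eq_zero]
  have hmem : ∀ p ∈ (quadTriples n).filter (fun p => Even p.2.1),
      (p.1, 2 * p.2.2, p.2.1 / 2) ∈ (quadTriples n).filter (fun p => Even p.2.1) := by
    rintro ⟨i, d, e⟩ hp
    rw [Finset.mem_filter, mem_quadTriples] at hp ⊢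
    obtain ⟨⟨hd, he, hp⟩, c, rfl⟩ := hp
    have : (c + c) / 2 = c := by omega
    dsimp only
    rw [this]
    refine ⟨⟨by omega, by omega, ?_⟩, even_two_mul e⟩
    rw [← hp]
    ring
  refine Finset.sum_nbij' (fun p => (p.1, 2 * p.2.2, p.2.1 / 2))
    (fun p => (p.1, 2 * p.2.2, p.2.1 / 2)) hmem hmem ?_ ?_ ?_
  all_goals
    rintro ⟨i, d, e⟩ hp
    obtain ⟨c, rfl⟩ : Even d := (Finset.mem_filter.1 hp).2
    have : (c + c) / 2 = c := by omega
    dsimp only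
    rw [this]
  · ext <;> dsimp only <;> omega
  · ext <;> dsimp only <;> omega
  · ring

theorem Int.coe_negOnePow_eq {a b : ℤ} (h : Even (a - b)) :
    (a.negOnePow : ℤ) = (b.negOnePow : ℤ) := by
  rw [(Int.negOnePow_eq_iff a b).2 h]

theorem Int.coe_negOnePow_mul_self (a : ℤ) : (a.negOnePow : ℤ) * a.negOnePow = 1 := by
  rw [← Units.val_mul, Int.units_mul_self, Units.val_one]

theorem Int.coe_negOnePow_add (a b : ℤ) :
    ((a + b).negOnePow : ℤ) = a.negOnePow * b.negOnePow := by
  rw [Int.negOnePow_add, Units.val_mul]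

theorem Int.coe_negOnePow_succ (a : ℤ) : ((a + 1).negOnePow : ℤ) = -a.negOnePow := by
  rw [Int.negOnePow_succ, Units.val_neg]

theorem sum_Ioo_two_mul (f : ℤ → ℤ) (hf : f 0 = 0) (s : ℕ) :
    ∑ x ∈ Finset.Ioo (0 : ℤ) (2 * s), f x =
      ∑ k ∈ Finset.range s, (f (2 * k) + f (2 * k + 1)) := by
  have h : ∑ x ∈ Finset.Ioo (0 : ℤ) (2 * s), f x = ∑ x ∈ Finset.Ico (0 : ℤ) (2 * s), f x := by
    refine Finset.sum_subset Finset.Ioo_subset_Ico_self fun x hx hx' => ?_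
    rw [Finset.mem_Ico] at hx
    rw [Finset.mem_Ioo] at hx'
    obtain rfl : x = 0 := by omega
    exact hf
  rw [h]
  clear h
  induction s with
  | zero => simp
  | succ s ih =>
    have : Finset.Ico (0 : ℤ) (2 * (s + 1 : ℕ)) =
        insert (2 * s + 1 : ℤ) (insert (2 * s : ℤ) (Finset.Ico (0 : ℤ) (2 * s))) := by
      ext x
      simp only [Finset.mem_insert, Finset.mem_Ico]
      omega
    rw [this, Finset.sum_insert (by simp), Finset.sum_insert (by simp), ih, Finset.sum_range_succ]
    ring

theorem sum_Ioo_neg (f : ℤ → ℤ) (hf : f 0 = 0) (hneg : ∀ x, f (-x) = f x) (s : ℕ) :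
    ∑ x ∈ Finset.Ioo (-(s : ℤ)) s, f x = 2 * ∑ k ∈ Finset.range s, f k := by
  induction s with
  | zero => simp
  | succ s ih =>
    rcases Nat.eq_zero_or_pos s with rfl | hs
    · have : Finset.Ioo (-((0 + 1 : ℕ) : ℤ)) ((0 + 1 : ℕ) : ℤ) = {0} := by
        ext x
        simp only [Finset.mem_singleton, Finset.mem_Ioo]
        omega
      rw [this]
      simp [hf]
    · have : Finset.Ioo (-((s + 1 : ℕ) : ℤ)) ((s + 1 : ℕ) : ℤ) =
          insert (s : ℤ) (insert (-s : ℤ) (Finset.Ioo (-(s : ℤ)) s)) := by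
        ext x
        simp only [Finset.mem_insert, Finset.mem_Ioo]
        omega
      rw [this, Finset.sum_insert, Finset.sum_insert (by simp), ih, Finset.sum_range_succ, hneg]
      · ring
      · simp only [Finset.mem_insert, Finset.mem_Ioo]
        omega

theorem chiFour_neg (z : ℤ) : ZMod.χ₄ (-z : ℤ) = -ZMod.χ₄ z := by
  push_cast
  generalize (z : ZMod 4) = w
  revert w
  decide

/-- Modulo 4, `2k` is `0` or `2` according to the parity of `k`, while `χ₄(-w) = -χ₄(w)` and `χ₄(2 -
w) = χ₄(w)`. -/
theorem negOnePow_mul_chiFour (k z : ℤ) :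
    (k.negOnePow : ℤ) * ZMod.χ₄ (2 * k - z : ℤ) = -ZMod.χ₄ z := by
  have h : ∀ w : ZMod 4, ZMod.χ₄ (-w) = -ZMod.χ₄ w ∧ ZMod.χ₄ (2 - w) = ZMod.χ₄ w := by decide
  rcases Int.even_or_odd' k with ⟨c, rfl | rfl⟩
  · rw [Int.negOnePow_even _ (even_two_mul c)]
    have : ((2 * (2 * c) - z : ℤ) : ZMod 4) = -(z : ZMod 4) := by
      have h4 : (4 : ZMod 4) = 0 := rfl
      push_cast
      linear_combination (c : ZMod 4) * h4
    rw [this, (h _).1]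
    simp
  · rw [Int.negOnePow_odd _ (odd_two_mul_add_one c)]
    have : ((2 * (2 * c + 1) - z : ℤ) : ZMod 4) = 2 - (z : ZMod 4) := by
      have h4 : (4 : ZMod 4) = 0 := rfl
      push_cast
      linear_combination (c : ZMod 4) * h4
    rw [this, (h _).2]
    simp

theorem chiFour_two_mul (k : ℤ) : ZMod.χ₄ (2 * k : ℤ) = 0 := by
  push_cast
  generalize (k : ZMod 4) = w
  revert w
  decide

theorem chiFour_two_mul_add_one (k : ℤ) : ZMod.χ₄ (2 * k + 1 : ℤ) = k.negOnePow := by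
  have h := negOnePow_mul_chiFour (k + 1) 1
  rw [Int.coe_negOnePow_succ, show 2 * (k + 1) - 1 = 2 * k + 1 by ring] at h
  have h1 : ZMod.χ₄ ((1 : ℤ) : ZMod 4) = 1 := by simp
  rw [h1] at h
  linear_combination (ZMod.χ₄ (2 * k + 1 : ℤ)) * (-Int.coe_negOnePow_mul_self k) -
    (k.negOnePow : ℤ) * h

/-! ### The test functions for two, four and eight squares -/

/-- With `F = (-1)^y χ₄(z) x y`, the sum at `(d + δ, i, d - δ)` is odd in `i` and vanishes. On the
other side the sign and character collapse to `-χ₄(δ)`, and the part of `(δ - 2i)(d + i)` even in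
`i` is `dδ - 2i² = n - 3i²`. -/
theorem sum_quadTriples_chiFour (n : ℤ) :
    ∑ p ∈ quadTriples n, (n - 3 * p.1 ^ 2) * ZMod.χ₄ p.2.1 = if IsSquare n then n else 0 := by
  set F : ℤ → ℤ → ℤ → ℤ := fun x y z => y.negOnePow * ZMod.χ₄ z * (x * y) with hF
  have hx : ∀ x y z, F (-x) y z = -F x y z := fun x y z => by
    simp only [hF]
    ring
  have hyz : ∀ x y z, F x (-y) (-z) = F x y z := fun x y z => by
    simp only [hF, chiFour_neg, Int.negOnePow_neg]
    ring
  have hB : ∑ p ∈ quadTriples n, F (p.2.1 + p.2.2) p.1 (p.2.1 - p.2.2) = 0 := by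
    have h := sum_quadTriples_neg n fun p => F (p.2.1 + p.2.2) p.1 (p.2.1 - p.2.2)
    have h' : ∑ p ∈ quadTriples n, F (p.2.1 + p.2.2) (-p.1) (p.2.1 - p.2.2) =
        ∑ p ∈ quadTriples n, -F (p.2.1 + p.2.2) p.1 (p.2.1 - p.2.2) := by
      refine Finset.sum_congr rfl fun p _ => ?_
      simp only [hF, Int.negOnePow_neg]
      ring
    rw [Finset.sum_neg_distrib] at h'
    dsimp only at h
    linarith
  have hA : 2 * ∑ p ∈ quadTriples n,
      F (p.2.2 - 2 * p.1) (p.2.1 + p.1) (2 * p.2.1 + 2 * p.1 - p.2.2) =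
      -(2 * ∑ p ∈ quadTriples n, (n - 3 * p.1 ^ 2) * ZMod.χ₄ p.2.1) := by
    rw [← sum_quadTriples_swap n fun p => (n - 3 * p.1 ^ 2) * ZMod.χ₄ p.2.1, two_mul]
    nth_rewrite 1 [← sum_quadTriples_neg]
    rw [← Finset.sum_add_distrib, Finset.mul_sum, ← Finset.sum_neg_distrib]
    refine Finset.sum_congr rfl ?_
    rintro ⟨i, d, e⟩ hp
    obtain ⟨_, _, hp⟩ := mem_quadTriples.1 hp
    have h1 := negOnePow_mul_chiFour (d + i) e
    have h2 := negOnePow_mul_chiFour (d + -i) e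
    simp only [hF]
    rw [show 2 * d + 2 * i - e = 2 * (d + i) - e by ring,
      show 2 * d + 2 * -i - e = 2 * (d + -i) - e by ring, h1, h2, ← hp]
    ring
  split_ifs with hn
  · obtain ⟨s, rfl⟩ : ∃ s : ℕ, n = (s : ℤ) ^ 2 := by
      obtain ⟨r, rfl⟩ := hn
      exact ⟨r.natAbs, by simp [sq]⟩
    have h := liouville_identity_sq hx hyz s
    have hsum : ∀ m : ℕ, ∑ k ∈ Finset.range m, ((2 * k + 1 : ℤ) * ((k : ℤ).negOnePow : ℤ)) =
        -((m : ℤ).negOnePow * m) := by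
      intro m
      induction m with
      | zero => simp
      | succ m ih =>
        rw [Finset.sum_range_succ, ih]
        push_cast
        rw [Int.coe_negOnePow_succ]
        ring
    -- In the first boundary sum `χ₄(x)` kills the even `x`; the second vanishes entirely because
    -- there `z = 2y`.
    rw [hA, hB, sum_Ioo_two_mul _ (by simp [hF]),
      Finset.sum_congr rfl (g := fun k : ℕ => ((s : ℤ).negOnePow * s : ℤ) *
        ((2 * k + 1 : ℤ) * ((k : ℤ).negOnePow : ℤ))), ← Finset.mul_sum, hsum,
      Finset.sum_eq_zero (s := Finset.Ioo (-(s : ℤ)) s)] at h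
    · refine mul_left_cancel₀ (two_ne_zero (α := ℤ)) ?_
      linear_combination -h + 2 * (s : ℤ) ^ 2 * Int.coe_negOnePow_mul_self s
    · intro y _
      simp only [hF, chiFour_two_mul]
      ring
    · intro k _
      simp only [hF, chiFour_two_mul, chiFour_two_mul_add_one]
      ring
  · have h := liouville_identity_of_not_isSquare hx hyz hn
    rw [hA, hB] at h
    linarith

/-- With `F = (-1)^(x+y) x y z`, the sum at `(d + δ, i, d - δ)` is odd under `d ↔ δ`. On the other
side the part of `x y z` even in `i` is `(2d - δ)(n - 5i²)`. -/
theorem sum_quadTriples_negOnePow_mul (n : ℤ) :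
    ∑ p ∈ quadTriples n, (n - 5 * p.1 ^ 2) *
      (((p.2.1 + 1) * (p.2.2 + 1)).negOnePow * p.2.1) = if IsSquare n then n else 0 := by
  set F : ℤ → ℤ → ℤ → ℤ := fun x y z => (x + y).negOnePow * (x * y * z) with hF
  have hx : ∀ x y z, F (-x) y z = -F x y z := fun x y z => by
    simp only [hF]
    rw [Int.coe_negOnePow_eq (show Even ((-x + y) - (x + y)) from ⟨-x, by ring⟩)]
    ring
  have hyz : ∀ x y z, F x (-y) (-z) = F x y z := fun x y z => by
    simp only [hF]
    rw [Int.coe_negOnePow_eq (show Even ((x + -y) - (x + y)) from ⟨-y, by ring⟩)]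
    ring
  have hB : ∑ p ∈ quadTriples n, F (p.2.1 + p.2.2) p.1 (p.2.1 - p.2.2) = 0 := by
    have h := sum_quadTriples_swap n fun p => F (p.2.1 + p.2.2) p.1 (p.2.1 - p.2.2)
    have h' : ∑ p ∈ quadTriples n, F (p.2.2 + p.2.1) p.1 (p.2.2 - p.2.1) =
        ∑ p ∈ quadTriples n, -F (p.2.1 + p.2.2) p.1 (p.2.1 - p.2.2) := by
      refine Finset.sum_congr rfl fun p _ => ?_
      simp only [hF, add_comm p.2.2]
      ring
    rw [Finset.sum_neg_distrib] at h'
    dsimp only at h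
    linarith
  have hA : 2 * ∑ p ∈ quadTriples n,
      F (p.2.2 - 2 * p.1) (p.2.1 + p.1) (2 * p.2.1 + 2 * p.1 - p.2.2) =
      -(n.negOnePow * (2 * ∑ p ∈ quadTriples n, (n - 5 * p.1 ^ 2) *
        (((p.2.1 + 1) * (p.2.2 + 1)).negOnePow * p.2.1))) := by
    have hS := sum_quadTriples_swap n fun p => (n - 5 * p.1 ^ 2) *
      (((p.2.1 + 1) * (p.2.2 + 1)).negOnePow * p.2.1)
    set S := ∑ p ∈ quadTriples n, (n - 5 * p.1 ^ 2) *
        (((p.2.1 + 1) * (p.2.2 + 1)).negOnePow * p.2.1) with hS'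
    -- The sign is symmetric in `d` and `δ`, so swapping them in one copy of `S` turns the weight
    -- `d` into the required `2d - δ`.
    rw [show 2 * S = 4 * S - 2 * S by ring]
    nth_rewrite 2 [← hS]
    rw [hS', two_mul]
    nth_rewrite 1 [← sum_quadTriples_neg]
    rw [← Finset.sum_add_distrib, Finset.mul_sum, Finset.mul_sum, ← Finset.sum_sub_distrib,
      Finset.mul_sum, ← Finset.sum_neg_distrib]
    refine Finset.sum_congr rfl ?_
    rintro ⟨i, d, e⟩ hp
    obtain ⟨_, _, hp⟩ := mem_quadTriples.1 hp
    simp only [hF]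
    have key : (n.negOnePow : ℤ) * (((d + 1) * (e + 1)).negOnePow : ℤ) =
        -((i + d + e).negOnePow : ℤ) := by
      rw [← Int.coe_negOnePow_succ, ← Int.coe_negOnePow_add]
      apply Int.coe_negOnePow_eq
      rw [← hp, show i ^ 2 + d * e + (d + 1) * (e + 1) - (i + d + e + 1) =
        i * (i - 1) + 2 * (d * e) by ring]
      exact (Int.even_mul_pred_self i).add (even_two_mul _)
    rw [Int.coe_negOnePow_eq (show Even ((e - 2 * i + (d + i)) - (i + d + e)) from ⟨-i, by ring⟩),
      Int.coe_negOnePow_eq (show Even ((e - 2 * -i + (d + -i)) - (i + d + e)) from ⟨0, by ring⟩),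
      mul_comm (e + 1) (d + 1)]
    linear_combination ((n - 5 * i ^ 2) * (4 * d - 2 * e)) * key +
      (((i + d + e).negOnePow : ℤ) * (4 * d - 2 * e)) * hp
  have hee := Int.coe_negOnePow_mul_self n
  split_ifs with hn
  · obtain ⟨s, rfl⟩ : ∃ s : ℕ, n = (s : ℤ) ^ 2 := by
      obtain ⟨r, rfl⟩ := hn
      exact ⟨r.natAbs, by simp [sq]⟩
    have h := liouville_identity_sq hx hyz s
    have hsum1 : ∀ m : ℕ, ∑ k ∈ Finset.range m, ((2 * k : ℤ) ^ 2 - (2 * k + 1 : ℤ) ^ 2) =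
        -(m * (2 * m - 1)) := by
      intro m
      induction m with
      | zero => simp
      | succ m ih =>
        rw [Finset.sum_range_succ, ih]
        push_cast
        ring
    have hsum2 : ∀ m : ℕ, 2 * ∑ k ∈ Finset.range m, ((k : ℤ).negOnePow * (k : ℤ) ^ 2 : ℤ) =
        -((m : ℤ).negOnePow * (m * (m - 1))) := by
      intro m
      induction m with
      | zero => simp
      | succ m ih =>
        rw [Finset.sum_range_succ, mul_add, ih]
        push_cast
        rw [Int.coe_negOnePow_succ]
        ring
    have e1 : ∑ x ∈ Finset.Ioo (0 : ℤ) (2 * s), F x s x =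
        -((s : ℤ).negOnePow * s * (s * (2 * s - 1))) := by
      rw [sum_Ioo_two_mul _ (by simp [hF]), ← mul_neg, ← hsum1, Finset.mul_sum]
      refine Finset.sum_congr rfl fun k _ => ?_
      simp only [hF, Int.coe_negOnePow_add, Int.negOnePow_two_mul, Int.negOnePow_one,
        Units.val_neg, Units.val_one]
      ring
    have e2 : ∑ y ∈ Finset.Ioo (-(s : ℤ)) s, F (2 * s) y (2 * y) =
        -(4 * s * ((s : ℤ).negOnePow * (s * (s - 1)))) := by
      rw [sum_Ioo_neg _ (by simp [hF]), ← mul_neg, ← hsum2, Finset.mul_sum, Finset.mul_sum,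
        Finset.mul_sum]
      · refine Finset.sum_congr rfl fun k _ => ?_
        simp only [hF, Int.coe_negOnePow_add, Int.negOnePow_two_mul, Units.val_one]
        ring
      · intro y
        rw [mul_neg, hyz]
    have e3 : (((s : ℤ) ^ 2).negOnePow : ℤ) = (s : ℤ).negOnePow := by
      apply Int.coe_negOnePow_eq
      rw [show (s : ℤ) ^ 2 - s = s * (s - 1) by ring]
      exact Int.even_mul_pred_self _
    rw [hA, hB, e1, e2, e3] at h
    rw [e3] at hee
    refine mul_left_cancel₀ (two_ne_zero (α := ℤ)) ?_
    linear_combination -((s : ℤ).negOnePow : ℤ) * h - (2 * (∑ p ∈ quadTriples ((s : ℤ) ^ 2),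
      ((s : ℤ) ^ 2 - 5 * p.1 ^ 2) * (((p.2.1 + 1) * (p.2.2 + 1)).negOnePow * p.2.1)) -
      2 * (s : ℤ) ^ 2) * hee
  · have h := liouville_identity_of_not_isSquare hx hyz hn
    rw [hA, hB] at h
    refine mul_left_cancel₀ (two_ne_zero (α := ℤ)) ?_
    linear_combination -(n.negOnePow : ℤ) * h - (2 * (∑ p ∈ quadTriples n,
      (n - 5 * p.1 ^ 2) * (((p.2.1 + 1) * (p.2.2 + 1)).negOnePow * p.2.1))) * hee

/-- The coefficients `7, -3, -3` in `F` make the part even in `i`, apart from the sign `(-1)^(d+i)`,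
equal to `(n - 9i²) d³ - (3n i² - 7i⁴)(d - 2δ)`. By `sum_quadTriples_even` and the symmetry `d ↔ δ`,
the second piece contributes a multiple of `∑ q(i) d` that cancels against the sum at `(d + δ, i, d
- δ)`. -/
theorem sum_quadTriples_negOnePow_mul_cube (n : ℤ) :
    ∑ p ∈ quadTriples n, (n - 9 * p.1 ^ 2) *
      ((p.2.1 * p.2.2 + p.2.1).negOnePow * p.2.1 ^ 3) = if IsSquare n then n else 0 := by
  set F : ℤ → ℤ → ℤ → ℤ :=
    fun x y z => y.negOnePow * (x * y ^ 2 * (7 * y ^ 2 - 3 * n - 3 * y * z)) with hF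
  set S := ∑ p ∈ quadTriples n, (n - 9 * p.1 ^ 2) *
    ((p.2.1 * p.2.2 + p.2.1).negOnePow * p.2.1 ^ 3) with hS
  set q : ℤ → ℤ := fun i => i.negOnePow * (3 * n * i ^ 2 - 7 * i ^ 4) with hq
  have hx : ∀ x y z, F (-x) y z = -F x y z := fun x y z => by
    simp only [hF]
    ring
  have hyz : ∀ x y z, F x (-y) (-z) = F x y z := fun x y z => by
    simp only [hF, Int.negOnePow_neg]
    ring
  have hswap : ∑ p ∈ quadTriples n, q p.1 * p.2.2 = ∑ p ∈ quadTriples n, q p.1 * p.2.1 :=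
    sum_quadTriples_swap n fun p => q p.1 * p.2.1
  have hB : ∑ p ∈ quadTriples n, F (p.2.1 + p.2.2) p.1 (p.2.1 - p.2.2) =
      -(2 * ∑ p ∈ quadTriples n, q p.1 * p.2.1) := by
    have h := sum_quadTriples_swap n fun p => F (p.2.1 + p.2.2) p.1 (p.2.1 - p.2.2)
    have h' : ∑ p ∈ quadTriples n, F (p.2.2 + p.2.1) p.1 (p.2.2 - p.2.1) +
        ∑ p ∈ quadTriples n, F (p.2.1 + p.2.2) p.1 (p.2.1 - p.2.2) =
        -(2 * (∑ p ∈ quadTriples n, q p.1 * p.2.2 + ∑ p ∈ quadTriples n, q p.1 * p.2.1)) := by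
      rw [← Finset.sum_add_distrib, ← Finset.sum_add_distrib, Finset.mul_sum,
        ← Finset.sum_neg_distrib]
      refine Finset.sum_congr rfl fun p _ => ?_
      simp only [hF, hq]
      ring
    rw [hswap] at h'
    dsimp only at h
    linarith
  have hA : 2 * ∑ p ∈ quadTriples n,
      F (p.2.2 - 2 * p.1) (p.2.1 + p.1) (2 * p.2.1 + 2 * p.1 - p.2.2) =
      n.negOnePow * (2 * S) - 2 * ∑ p ∈ quadTriples n, q p.1 * p.2.1 := by
    have hE := sum_quadTriples_even n q
    have key : 2 * ∑ p ∈ quadTriples n,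
        F (p.2.2 - 2 * p.1) (p.2.1 + p.1) (2 * p.2.1 + 2 * p.1 - p.2.2) =
        n.negOnePow * (2 * S) - 2 * (∑ p ∈ quadTriples n,
          q p.1 * (1 + (p.2.1.negOnePow : ℤ)) * (p.2.1 - 2 * p.2.2) -
          ∑ p ∈ quadTriples n, q p.1 * p.2.1 + 2 * ∑ p ∈ quadTriples n, q p.1 * p.2.2) := by
      rw [two_mul]
      nth_rewrite 1 [← sum_quadTriples_neg]
      rw [hS, ← Finset.sum_add_distrib, ← Finset.sum_sub_distrib, Finset.mul_sum, Finset.mul_sum,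
        Finset.mul_sum, ← Finset.sum_add_distrib, Finset.mul_sum, ← Finset.sum_sub_distrib]
      refine Finset.sum_congr rfl ?_
      rintro ⟨i, d, e⟩ hp
      obtain ⟨_, _, hp⟩ := mem_quadTriples.1 hp
      have hs : (n.negOnePow : ℤ) * ((d * e + d).negOnePow : ℤ) =
          (i.negOnePow : ℤ) * (d.negOnePow : ℤ) := by
        rw [← Int.coe_negOnePow_add, ← Int.coe_negOnePow_add]
        apply Int.coe_negOnePow_eq
        rw [← hp, show i ^ 2 + d * e + (d * e + d) - (i + d) =
          i * (i - 1) + 2 * (d * e) by ring]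
        exact (Int.even_mul_pred_self i).add (even_two_mul _)
      simp only [hF, hq, Int.coe_negOnePow_add, Int.negOnePow_neg] at hs ⊢
      rw [show ∀ t u v w : ℤ, t * (2 * (u * (v * w))) = 2 * u * w * (t * v) by intros; ring, hs,
        ← hp]
      ring
    rw [key, hE, hswap]
    ring
  have hee := Int.coe_negOnePow_mul_self n
  split_ifs with hn
  · obtain ⟨s, hs⟩ : ∃ s : ℕ, n = (s : ℤ) ^ 2 := by
      obtain ⟨r, rfl⟩ := hn
      exact ⟨r.natAbs, by simp [sq]⟩
    have h := liouville_identity_sq hx hyz s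
    rw [← hs, hA, hB] at h
    have hsum1 : ∀ m : ℕ, ∑ k ∈ Finset.range m,
        ((2 * k : ℤ) * (4 * s - 3 * (2 * k)) + (2 * k + 1 : ℤ) * (4 * s - 3 * (2 * k + 1))) =
        m * (2 * m - 1) * (4 * s - (4 * m - 1)) := by
      intro m
      induction m with
      | zero => simp
      | succ m ih =>
        rw [Finset.sum_range_succ, ih]
        push_cast
        ring
    have hsum2 : ∀ m : ℕ, 2 * ∑ k ∈ Finset.range m,
        ((k : ℤ).negOnePow * ((k : ℤ) ^ 4 - 3 * s ^ 2 * k ^ 2) : ℤ) =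
        -((m : ℤ).negOnePow * (m * (m - 1) * (m ^ 2 - m - 1 - 3 * s ^ 2))) := by
      intro m
      induction m with
      | zero => simp
      | succ m ih =>
        rw [Finset.sum_range_succ, mul_add, ih]
        push_cast
        rw [Int.coe_negOnePow_succ]
        ring
    have e1 : ∑ x ∈ Finset.Ioo (0 : ℤ) (2 * s), F x s x =
        (s : ℤ).negOnePow * s ^ 3 * (s * (2 * s - 1) * (4 * s - (4 * s - 1))) := by
      rw [sum_Ioo_two_mul _ (by simp [hF]), ← hsum1, Finset.mul_sum]
      refine Finset.sum_congr rfl fun k _ => ?_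
      simp only [hF, hs]
      ring
    have e2 : ∑ y ∈ Finset.Ioo (-(s : ℤ)) s, F (2 * s) y (2 * y) =
        2 * s * -((s : ℤ).negOnePow * (s * (s - 1) * (s ^ 2 - s - 1 - 3 * s ^ 2))) := by
      rw [sum_Ioo_neg _ (by simp [hF]), ← hsum2, Finset.mul_sum, Finset.mul_sum, Finset.mul_sum]
      · refine Finset.sum_congr rfl fun k _ => ?_
        simp only [hF, hs]
        ring
      · intro y
        rw [mul_neg, hyz]
    have e3 : (n.negOnePow : ℤ) = (s : ℤ).negOnePow := by
      apply Int.coe_negOnePow_eq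
      rw [hs, show (s : ℤ) ^ 2 - s = s * (s - 1) by ring]
      exact Int.even_mul_pred_self _
    rw [e1, e2, e3] at h
    rw [e3] at hee
    rw [hs]
    refine mul_left_cancel₀ (two_ne_zero (α := ℤ)) ?_
    linear_combination ((s : ℤ).negOnePow : ℤ) * h - (2 * S - 2 * (s : ℤ) ^ 2) * hee
  · have h := liouville_identity_of_not_isSquare hx hyz hn
    rw [hA, hB] at h
    refine mul_left_cancel₀ (two_ne_zero (α := ℤ)) ?_
    linear_combination (n.negOnePow : ℤ) * h - 2 * S * hee

/-! ### Divisor sums and Jacobi's theorems -/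

/-- The pairs of positive integers with product `k`. -/
noncomputable def divisorPairs (k : ℤ) : Finset (ℤ × ℤ) :=
  {p ∈ Finset.Icc 1 k ×ˢ Finset.Icc 1 k | p.1 * p.2 = k}

theorem mem_divisorPairs {k d e : ℤ} : (d, e) ∈ divisorPairs k ↔ 0 < d ∧ 0 < e ∧ d * e = k := by
  simp only [divisorPairs, Finset.mem_filter, Finset.mem_product, Finset.mem_Icc]
  constructor
  · rintro ⟨⟨⟨h1, _⟩, h2, _⟩, h⟩
    exact ⟨by omega, by omega, h⟩
  · rintro ⟨hd, he, h⟩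
    refine ⟨⟨⟨?_, ?_⟩, ?_, ?_⟩, h⟩ <;> nlinarith

theorem divisorPairs_of_nonpos {k : ℤ} (hk : k ≤ 0) : divisorPairs k = ∅ := by
  rw [Finset.eq_empty_iff_forall_notMem]
  rintro ⟨d, e⟩ h
  obtain ⟨hd, he, h⟩ := mem_divisorPairs.1 h
  nlinarith [mul_pos hd he]

theorem sum_quadTriples_eq (n : ℤ) (f : ℤ × ℤ × ℤ → ℤ) :
    ∑ p ∈ quadTriples n, f p =
      ∑ i ∈ Finset.Icc (-n) n, ∑ q ∈ divisorPairs (n - i ^ 2), f (i, q) := by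
  rw [Finset.sum_sigma']
  refine Finset.sum_nbij' (fun p => ⟨p.1, p.2⟩) (fun p => (p.1, p.2)) ?_ ?_ ?_ ?_ ?_
  · rintro ⟨i, d, e⟩ hp
    have h := (Finset.mem_product.1 (Finset.mem_filter.1 hp).1).1
    obtain ⟨hd, he, hp⟩ := mem_quadTriples.1 hp
    exact Finset.mem_sigma.2 ⟨h, mem_divisorPairs.2 ⟨hd, he, by linarith⟩⟩
  · rintro ⟨i, d, e⟩ hp
    obtain ⟨hd, he, hp⟩ := mem_divisorPairs.1 (Finset.mem_sigma.1 hp).2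
    exact mem_quadTriples.2 ⟨hd, he, by linarith⟩
  · intro p _
    rfl
  · intro p _
    rfl
  · intro p _
    rfl

/-- Positivity of `n` makes `√n` and `-√n` distinct, which gives the factor `2`. -/
theorem sum_Icc_sq_eq (n : ℕ) (hn : 0 < n) (f : ℤ → ℤ) (hf : ∀ i, f (-i) = f i) :
    ∑ i ∈ Finset.Icc (-(n : ℤ)) n, (if (n : ℤ) - i ^ 2 = 0 then f i else 0) =
      if IsSquare (n : ℤ) then 2 * f (Nat.sqrt n) else 0 := by
  rw [← Finset.sum_filter]
  split_ifs with h
  · obtain ⟨s, hs⟩ : ∃ s : ℕ, n = s ^ 2 := by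
      obtain ⟨r, hr⟩ := h
      refine ⟨r.natAbs, ?_⟩
      zify
      rw [hr, sq_abs, sq]
    have hs0 : 0 < s := Nat.pos_of_ne_zero fun h0 => by subst h0; simp at hs; omega
    have : {i ∈ Finset.Icc (-(n : ℤ)) n | (n : ℤ) - i ^ 2 = 0} = {(s : ℤ), -(s : ℤ)} := by
      ext i
      simp only [Finset.mem_filter, Finset.mem_Icc, Finset.mem_insert, Finset.mem_singleton]
      rw [hs]
      push_cast
      rw [sub_eq_zero, eq_comm (a := (s : ℤ) ^ 2), sq_eq_sq_iff_eq_or_eq_neg]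
      refine and_iff_right_of_imp ?_
      have : (s : ℤ) ≤ s ^ 2 := Int.le_self_sq s
      rintro (rfl | rfl) <;> constructor <;> omega
    rw [this, Finset.sum_pair (by omega), hf, hs, Nat.sqrt_eq', two_mul]
  · refine Finset.sum_eq_zero fun i hi => absurd ⟨i, ?_⟩ h
    have := (Finset.mem_filter.1 hi).2
    linarith

/-- A divisor sum gives the number of representations as sums of `m` squares, as soon as it
satisfies the recursion. -/
theorem sumSquaresCount_eq_of_sum_quadTriples (m : ℕ) (h : ℤ × ℤ → ℤ)
    (hsum : ∀ n : ℤ, ∑ p ∈ quadTriples n, (n - (m + 1) * p.1 ^ 2) * h p.2 =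
      if IsSquare n then n else 0) {n : ℕ} (hn : 0 < n) :
    (sumSquaresCount m n : ℤ) = 2 * m * ∑ q ∈ divisorPairs n, h q := by
  set g : ℤ → ℤ := fun k => (if k = 0 then 1 else 0) + 2 * m * ∑ q ∈ divisorPairs k, h q with hg
  have key := eq_sumSquaresCountInt_of_recursion m g ?_ ?_ ?_ n
  · rw [← sumSquaresCountInt_natCast, ← key, hg]
    simp [hn.ne']
  · intro k hk
    simp [hg, divisorPairs_of_nonpos hk.le, hk.ne]
  · simp [hg, divisorPairs_of_nonpos le_rfl]
  · intro n hn
    have h1 := hsum n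
    rw [sum_quadTriples_eq] at h1
    have h2 := sum_Icc_sq_eq n hn (fun i => (n : ℤ) - (m + 1) * i ^ 2) fun i => by ring
    have h3 : ∑ i ∈ Finset.Icc (-(n : ℤ)) n, ((n : ℤ) - (m + 1) * i ^ 2) * g (n - i ^ 2) =
        ∑ i ∈ Finset.Icc (-(n : ℤ)) n,
          (if (n : ℤ) - i ^ 2 = 0 then ((n : ℤ) - (m + 1) * i ^ 2) else 0) +
        2 * (m : ℤ) * ∑ i ∈ Finset.Icc (-(n : ℤ)) n, ∑ q ∈ divisorPairs (n - i ^ 2),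
          ((n : ℤ) - (m + 1) * i ^ 2) * h q := by
      rw [Finset.mul_sum, ← Finset.sum_add_distrib]
      refine Finset.sum_congr rfl fun i _ => ?_
      simp only [hg, ← Finset.mul_sum]
      split_ifs <;> ring
    -- For square `n` the terms `i = ±√n` give `2(n - (m + 1)n) = -2mn`, cancelling the `2m * n`
    -- from the divisor sum.
    rw [h3, h1, h2]
    split_ifs with hsq
    · have : ((Nat.sqrt n : ℕ) : ℤ) ^ 2 = n := by
        obtain ⟨r, hr⟩ := hsq
        have : n = r.natAbs ^ 2 := by
          zify
          rw [hr, sq_abs, sq]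
        rw [this, Nat.sqrt_eq']
        push_cast
        ring
      rw [this]
      ring
    · ring

theorem sum_divisorPairs_eq (n : ℕ) (f : ℤ → ℤ) :
    ∑ q ∈ divisorPairs n, f q.1 = ∑ d ∈ n.divisors, f d := by
  symm
  refine Finset.sum_bij (fun d _ => ((d : ℤ), ((n / d : ℕ) : ℤ))) ?_ ?_ ?_ ?_
  · intro d hd
    have hd0 := Nat.pos_of_mem_divisors hd
    have hdn := Nat.dvd_of_mem_divisors hd
    have hn0 : n ≠ 0 := (Nat.mem_divisors.1 hd).2
    rw [mem_divisorPairs]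
    refine ⟨by exact_mod_cast hd0, ?_, ?_⟩
    · exact_mod_cast Nat.div_pos (Nat.le_of_dvd (Nat.pos_of_ne_zero hn0) hdn) hd0
    · exact_mod_cast Nat.mul_div_cancel' hdn
  · intro d _ d' _ h
    have h1 := (Prod.ext_iff.1 h).1
    exact_mod_cast (show (d : ℤ) = d' from h1)
  · rintro ⟨d, e⟩ h
    obtain ⟨hd, he, h⟩ := mem_divisorPairs.1 h
    lift d to ℕ using hd.le
    lift e to ℕ using he.le
    have hd0 : 0 < d := by exact_mod_cast hd
    have he0 : 0 < e := by exact_mod_cast he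
    have h' : d * e = n := by exact_mod_cast h
    refine ⟨d, ?_, ?_⟩
    · rw [← h']
      exact Nat.mem_divisors.2 ⟨dvd_mul_right d e, (Nat.mul_pos hd0 he0).ne'⟩
    · rw [← h', Nat.mul_div_cancel_left e hd0]
  · intro d _
    rfl

theorem etaOne_eq_chiFour (n : ℕ) : etaOne n = ZMod.χ₄ ((n : ℤ) : ZMod 4) := by
  rw [etaOne]
  rcases Nat.even_or_odd' n with ⟨c, rfl | rfl⟩
  · rw [if_pos (even_two_mul c)]
    push_cast
    exact_mod_cast (chiFour_two_mul c).symm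
  · rw [if_neg (by simp)]
    have := chiFour_two_mul_add_one c
    push_cast at this ⊢
    rw [this]
    simp [Int.negOnePow_def]

/-- Jacobi's two-square theorem. -/
theorem sumSquaresCount_two {n : ℕ} (hn : 0 < n) :
    (sumSquaresCount 2 n : ℤ) = 4 * ∑ d ∈ n.divisors, etaOne d := by
  have h := sumSquaresCount_eq_of_sum_quadTriples 2 (fun q => ZMod.χ₄ q.1)
    (fun n => by rw [← sum_quadTriples_chiFour]; norm_num) hn
  rw [h, sum_divisorPairs_eq n fun d => ZMod.χ₄ d]
  simp only [etaOne_eq_chiFour]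
  norm_num

/-- The sign is `-1` exactly when both factors are even, so the sum is `∑ d` minus `∑ 2d` over such
pairs. The bijection `(d, δ) ↦ (2d, δ/2)` identifies the latter with the sum of the divisors that
are multiples of `4`. -/
theorem sum_divisorPairs_negOnePow_mul (n : ℕ) :
    ∑ q ∈ divisorPairs n, (((q.1 + 1) * (q.2 + 1)).negOnePow : ℤ) * q.1 =
      ∑ d ∈ n.divisors, etaTwo d := by
  have h1 : ∑ q ∈ divisorPairs n, (((q.1 + 1) * (q.2 + 1)).negOnePow : ℤ) * q.1 =
      ∑ q ∈ divisorPairs n, q.1 -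
      ∑ q ∈ divisorPairs n with Even q.1 ∧ Even q.2, 2 * q.1 := by
    rw [Finset.sum_filter, ← Finset.sum_sub_distrib]
    refine Finset.sum_congr rfl fun q _ => ?_
    split_ifs with hq
    · rw [Int.negOnePow_odd _ (hq.1.add_one.mul hq.2.add_one)]
      push_cast
      ring
    · rw [Int.negOnePow_even]
      · simp
      · rw [Int.even_mul, Int.even_add_one, Int.even_add_one]
        tauto
  have h2 : ∑ d ∈ n.divisors, etaTwo d = ∑ q ∈ divisorPairs n, q.1 -
      ∑ q ∈ divisorPairs n with 4 ∣ q.1, q.1 := by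
    rw [Finset.sum_filter, ← Finset.sum_sub_distrib,
      sum_divisorPairs_eq n fun d => d - if 4 ∣ d then d else 0]
    refine Finset.sum_congr rfl fun d _ => ?_
    rw [etaTwo]
    have : (4 : ℤ) ∣ d ↔ 4 ∣ d := by exact_mod_cast Int.natCast_dvd_natCast (m := 4) (n := d)
    simp only [this]
    split_ifs <;> ring
  rw [h1, h2]
  congr 1
  refine Finset.sum_nbij' (fun q => (2 * q.1, q.2 / 2)) (fun q => (q.1 / 2, 2 * q.2)) ?_ ?_ ?_ ?_ ?_
  · rintro ⟨d, e⟩ h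
    obtain ⟨h, hd, he⟩ := Finset.mem_filter.1 h
    obtain ⟨c, rfl⟩ := hd.two_dvd
    obtain ⟨b, rfl⟩ := he.two_dvd
    obtain ⟨hd, he, h⟩ := mem_divisorPairs.1 h
    dsimp only
    rw [Int.mul_ediv_cancel_left b two_ne_zero, Finset.mem_filter, mem_divisorPairs, ← h]
    exact ⟨⟨by omega, by omega, by ring⟩, c, by dsimp only; ring⟩
  · rintro ⟨d, e⟩ h
    obtain ⟨h, c, hc⟩ := Finset.mem_filter.1 h
    obtain rfl : d = 2 * (2 * c) := by dsimp only at hc; omega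
    obtain ⟨hd, he, h⟩ := mem_divisorPairs.1 h
    dsimp only
    rw [Int.mul_ediv_cancel_left (2 * c) two_ne_zero, Finset.mem_filter, mem_divisorPairs, ← h]
    exact ⟨⟨by omega, by omega, by ring⟩, even_two_mul c, even_two_mul e⟩
  · rintro ⟨d, e⟩ h
    obtain ⟨-, -, he⟩ := Finset.mem_filter.1 h
    have := he.two_dvd
    ext <;> dsimp only at this ⊢ <;> omega
  · rintro ⟨d, e⟩ h
    obtain ⟨-, hd⟩ := Finset.mem_filter.1 h
    ext <;> dsimp only at hd ⊢ <;> omega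
  · rintro ⟨d, e⟩ _
    rfl

/-- Jacobi's four-square theorem. -/
theorem sumSquaresCount_four {n : ℕ} (hn : 0 < n) :
    (sumSquaresCount 4 n : ℤ) = 8 * ∑ d ∈ n.divisors, etaTwo d := by
  have h := sumSquaresCount_eq_of_sum_quadTriples 4
    (fun q => (((q.1 + 1) * (q.2 + 1)).negOnePow : ℤ) * q.1)
    (fun n => by rw [← sum_quadTriples_negOnePow_mul]; norm_num) hn
  rw [h, sum_divisorPairs_negOnePow_mul]
  norm_num

/-- Jacobi's eight-square theorem. -/
theorem sumSquaresCount_eight {n : ℕ} (hn : 0 < n) :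
    (-1) ^ n * (sumSquaresCount 8 n : ℤ) = 16 * ∑ d ∈ n.divisors, (-1) ^ d * (d : ℤ) ^ 3 := by
  have h := sumSquaresCount_eq_of_sum_quadTriples 8
    (fun q => ((q.1 * q.2 + q.1).negOnePow : ℤ) * q.1 ^ 3)
    (fun n => by rw [← sum_quadTriples_negOnePow_mul_cube]; norm_num) hn
  have hpow : ∀ d : ℕ, ((d : ℤ).negOnePow : ℤ) = (-1) ^ d := fun d => by
    simp [Int.negOnePow_def]
  have h' : ∑ q ∈ divisorPairs n, ((q.1 * q.2 + q.1).negOnePow : ℤ) * q.1 ^ 3 =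
      ((n : ℤ).negOnePow : ℤ) * ∑ d ∈ n.divisors, (-1) ^ d * (d : ℤ) ^ 3 := by
    have := sum_divisorPairs_eq n fun d => (d.negOnePow : ℤ) * d ^ 3
    simp only [hpow] at this
    rw [← this, Finset.mul_sum]
    refine Finset.sum_congr rfl ?_
    rintro ⟨d, e⟩ hq
    obtain ⟨_, _, hq⟩ := mem_divisorPairs.1 hq
    dsimp only
    rw [hq, Int.coe_negOnePow_add, mul_assoc]
  rw [h, h', ← hpow]
  push_cast
  linear_combination (16 * ∑ d ∈ n.divisors, (-1) ^ d * (d : ℤ) ^ 3) *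
    Int.coe_negOnePow_mul_self n

/-! ### Convolution with the pentagonal coefficients -/

theorem sum_divisors_mul_pentagonalCoeff (η : ℕ → ℤ) (n : ℕ) :
    ∑ k ∈ Finset.Icc 1 n, (∑ d ∈ k.divisors, η d) * pentagonalCoeff ((n : ℤ) - k) =
      ∑ p ∈ Finset.HasAntidiagonal.antidiagonal n with 1 ≤ p.1,
        η p.1 * pentagonalProgressionSum p.1 p.2 := by
  have hL : ∑ k ∈ Finset.Icc 1 n, (∑ d ∈ k.divisors, η d) * pentagonalCoeff ((n : ℤ) - k) =
      ∑ x ∈ (Finset.Icc 1 n).sigma fun k => k.divisors,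
        η x.2 * pentagonalCoeff ((n : ℤ) - x.1) := by
    rw [Finset.sum_sigma]
    simp only [Finset.sum_mul]
  have hR : ∑ p ∈ Finset.HasAntidiagonal.antidiagonal n with 1 ≤ p.1,
        η p.1 * pentagonalProgressionSum p.1 p.2 =
      ∑ x ∈ (Finset.Icc 1 n).sigma fun m => Finset.range (n - m + 1),
        η x.1 * pentagonalCoeff ((n : ℤ) - x.1 * (x.2 + 1)) := by
    rw [Finset.sum_sigma]
    refine Finset.sum_nbij' (fun p => p.1) (fun m => (m, n - m)) ?_ ?_ ?_ ?_ ?_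
    · rintro ⟨m, k⟩ h
      simp only [Finset.mem_filter, Finset.HasAntidiagonal.mem_antidiagonal, Finset.mem_Icc] at h ⊢
      omega
    · intro m h
      simp only [Finset.mem_filter, Finset.HasAntidiagonal.mem_antidiagonal, Finset.mem_Icc] at h ⊢
      omega
    · rintro ⟨m, k⟩ h
      simp only [Finset.mem_filter, Finset.HasAntidiagonal.mem_antidiagonal] at h
      ext <;> dsimp only
      omega
    · intro m _
      rfl
    · rintro ⟨m, k⟩ h
      simp only [Finset.mem_filter, Finset.HasAntidiagonal.mem_antidiagonal] at h
      obtain ⟨rfl, hm⟩ := h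
      dsimp only
      rw [pentagonalProgressionSum_eq hm, Finset.mul_sum, Nat.add_sub_cancel_left]
      refine Finset.sum_congr rfl fun j _ => ?_
      congr 2
      push_cast
      ring
  rw [hL, hR]
  -- The shift by `1` is needed because the progression for `m` starts at `n - m`, so `j = 0`
  -- corresponds to `k = m`. Pairs `(m, j)` outside the image have `m (j + 1) > n`, where `ω` is
  -- evaluated at a negative integer.
  refine Finset.sum_of_injOn (fun x => ⟨x.2, x.1 / x.2 - 1⟩) ?_ ?_ ?_ ?_
  · rintro ⟨k, d⟩ hx ⟨k', d'⟩ hx' h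
    simp only [Finset.coe_sigma, Set.mem_sigma_iff, Finset.mem_coe, Finset.mem_Icc,
      Nat.mem_divisors, Sigma.mk.injEq, heq_eq_eq] at hx hx' h
    obtain ⟨rfl, h⟩ := h
    obtain ⟨⟨hk, _⟩, ⟨c, rfl⟩, _⟩ := hx
    obtain ⟨⟨hk', _⟩, ⟨c', rfl⟩, _⟩ := hx'
    have hd : 0 < d := Nat.pos_of_mul_pos_right (by omega : 0 < d * c)
    have hc : 0 < c := Nat.pos_of_mul_pos_left (by omega : 0 < d * c)
    have hc' : 0 < c' := Nat.pos_of_mul_pos_left (by omega : 0 < d * c')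
    rw [Nat.mul_div_cancel_left _ hd, Nat.mul_div_cancel_left _ hd] at h
    obtain rfl : c = c' := by omega
    rfl
  · rintro ⟨k, d⟩ hx
    simp only [Finset.coe_sigma, Set.mem_sigma_iff, Finset.mem_coe, Finset.mem_Icc,
      Nat.mem_divisors, Finset.mem_range] at hx ⊢
    obtain ⟨⟨hk, hkn⟩, ⟨c, rfl⟩, _⟩ := hx
    have hd : 0 < d := Nat.pos_of_mul_pos_right (by omega : 0 < d * c)
    have hc : 0 < c := Nat.pos_of_mul_pos_left (by omega : 0 < d * c)
    rw [Nat.mul_div_cancel_left _ hd]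
    refine ⟨⟨hd, by nlinarith⟩, ?_⟩
    have : d + c ≤ d * c + 1 := by nlinarith
    omega
  · rintro ⟨m, j⟩ hx hx'
    simp only [Finset.mem_sigma, Finset.mem_Icc, Finset.mem_range] at hx
    dsimp only
    rw [pentagonalCoeff_of_neg, mul_zero]
    by_contra! hle
    refine hx' ⟨⟨m * (j + 1), m⟩, ?_, ?_⟩
    · simp only [Finset.coe_sigma, Set.mem_sigma_iff, Finset.mem_coe, Finset.mem_Icc,
        Nat.mem_divisors]
      have h1 : 0 < m * (j + 1) := Nat.mul_pos hx.1.1 j.succ_pos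
      refine ⟨⟨h1, ?_⟩, dvd_mul_right _ _, h1.ne'⟩
      zify
      linarith
    · dsimp only
      rw [Nat.mul_div_cancel_left _ hx.1.1, Nat.add_sub_cancel]
  · rintro ⟨k, d⟩ hx
    simp only [Finset.mem_sigma, Finset.mem_Icc, Nat.mem_divisors] at hx ⊢
    obtain ⟨⟨hk, hkn⟩, ⟨c, rfl⟩, _⟩ := hx
    have hd : 0 < d := Nat.pos_of_mul_pos_right (by omega : 0 < d * c)
    have hc : 0 < c := Nat.pos_of_mul_pos_left (by omega : 0 < d * c)
    rw [Nat.mul_div_cancel_left _ hd]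
    congr 2
    push_cast [Nat.cast_sub (show 1 ≤ c from hc)]
    ring

theorem mainTheorem8 (n : ℕ) :
    (∑ k ∈ Finset.Icc 1 n, (sumSquaresCount 2 k : ℤ) * pentagonalCoeff ((n : ℤ) - (k : ℤ)) =
      4 * ∑ p ∈ Finset.HasAntidiagonal.antidiagonal n with 1 ≤ p.1,
        etaOne p.1 * pentagonalProgressionSum p.1 p.2) ∧
    (∑ k ∈ Finset.Icc 1 n, (sumSquaresCount 4 k : ℤ) * pentagonalCoeff ((n : ℤ) - (k : ℤ)) =
      8 * ∑ p ∈ Finset.HasAntidiagonal.antidiagonal n with 1 ≤ p.1,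
        etaTwo p.1 * pentagonalProgressionSum p.1 p.2) ∧
    (∑ k ∈ Finset.Icc 1 n,
        (-1 : ℤ) ^ k * (sumSquaresCount 8 k : ℤ) * pentagonalCoeff ((n : ℤ) - (k : ℤ)) =
      16 * ∑ p ∈ Finset.HasAntidiagonal.antidiagonal n with 1 ≤ p.1,
        (-1 : ℤ) ^ p.1 * (p.1 : ℤ) ^ 3 * pentagonalProgressionSum p.1 p.2) := by
  refine ⟨?_, ?_, ?_⟩
  · rw [← sum_divisors_mul_pentagonalCoeff, Finset.mul_sum]
    refine Finset.sum_congr rfl fun k hk => ?_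
    rw [sumSquaresCount_two (Finset.mem_Icc.1 hk).1, mul_assoc]
  · rw [← sum_divisors_mul_pentagonalCoeff, Finset.mul_sum]
    refine Finset.sum_congr rfl fun k hk => ?_
    rw [sumSquaresCount_four (Finset.mem_Icc.1 hk).1, mul_assoc]
  · rw [← sum_divisors_mul_pentagonalCoeff fun d => (-1 : ℤ) ^ d * (d : ℤ) ^ 3, Finset.mul_sum]
    refine Finset.sum_congr rfl fun k hk => ?_
    rw [sumSquaresCount_eight (Finset.mem_Icc.1 hk).1, mul_assoc]
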